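/- **Theorem 1.4.** There are a randomized algorithm $P$ and a constant $C$ such that the following holds for all integers $n \ge 1$, $r \ge 1$ and $0 \le k \le n$ and every simple undirected graph $G$ on $n$ vertices whose adjacency matrix $A_G$ has rank at most $r$ over $\mathbb{R}$. On input $(G,k)$, with $G$ given by its adjacency matrix, $P$ halts after at most $C \cdot n^{C r}$ steps (that is, in time $n^{O(r)}$) for all outcomes of its coin tosses. If $G$ has a vertex cover of size $k$, then $P$ accepts with probability at least $2/3$; if $G$ has no vertex cover of size $k$, then $P$ never accepts. Here a vertex cover is a set of vertices that contains at least one endpoint of every edge. An algorithm is a program for a random access machine with registers for natural numbers, indirect addressing, addition, truncated subtraction, conditional jumps and fair coin tosses, where each instruction counts as one step. -/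

import Mathlib

/-! ## Randomized random access machines -/

namespace RAM

/-- Instructions of a random access machine. The machine has registers `R 0, R 1, R 2, …` holding
natural numbers and a read-only input array `w` of natural numbers. -/
inductive Instr : Type
  /-- `R d := c` -/
  | const (d c : ℕ)
  /-- `R d := R a + R b` -/
  | add (d a b : ℕ)
  /-- `R d := max (R a - R b) 0` -/
  | sub (d a b : ℕ)
  /-- `R d := R (R a)` -/
  | load (d a : ℕ)
  /-- `R (R d) := R a` -/
  | store (d a : ℕ)
  /-- `R d := w[R a]`, the input word with index `R a` (zero beyond the end of the input) -/
  | read (d a : ℕ)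
  /-- `R d := ` a fair random bit -/
  | coin (d : ℕ)
  /-- go to instruction number `l` -/
  | jump (l : ℕ)
  /-- go to instruction number `l` if `R a = 0`, and to the next instruction otherwise -/
  | jz (a l : ℕ)

/-- A program is a finite list of instructions, numbered from `0`. -/
abbrev Program : Type := List Instr

/-- A configuration: the number of the next instruction, and the contents of the registers. -/
structure Cfg : Type where
  pc : ℕ
  reg : ℕ → ℕ

/-- The machine has halted when the program counter is past the end of the program. -/
def Halted (P : Program) (c : Cfg) : Prop := P.length ≤ c.pc

/-- The machine accepts when it has halted with `R 0 = 1`. -/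
def Accepting (P : Program) (c : Cfg) : Prop := Halted P c ∧ c.reg 0 = 1

instance (P : Program) (c : Cfg) : Decidable (Halted P c) :=
  inferInstanceAs (Decidable (P.length ≤ c.pc))

instance (P : Program) (c : Cfg) : Decidable (Accepting P c) :=
  inferInstanceAs (Decidable (Halted P c ∧ c.reg 0 = 1))

/-- Write the value `v` to the register `d` and go on to the next instruction. -/
def Cfg.write (c : Cfg) (d v : ℕ) : Cfg := ⟨c.pc + 1, Function.update c.reg d v⟩

/-- The effect of one instruction; `b` is the outcome of a coin toss, which only `coin` looks at. -/
def Instr.exec (w : List ℕ) (b : Bool) (c : Cfg) : Instr → Cfg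
  | .const d v => c.write d v
  | .add d a a' => c.write d (c.reg a + c.reg a')
  | .sub d a a' => c.write d (c.reg a - c.reg a')
  | .load d a => c.write d (c.reg (c.reg a))
  | .store d a => c.write (c.reg d) (c.reg a)
  | .read d a => c.write d (w.getD (c.reg a) 0)
  | .coin d => c.write d b.toNat
  | .jump l => ⟨l, c.reg⟩
  | .jz a l => if c.reg a = 0 then ⟨l, c.reg⟩ else ⟨c.pc + 1, c.reg⟩

/-- One step of the program `P` on input `w`: execute the instruction at the program counter. A
halted machine stays as it is. -/
def step (P : Program) (w : List ℕ) (c : Cfg) (b : Bool) : Cfg :=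
  match P[c.pc]? with
  | none => c
  | some i => i.exec w b c

/-- The configuration that the program `P` reaches on input `w` after as many steps as there are
entries in `coins`, where the `t`-th step uses the `t`-th entry as its coin toss. All registers
are zero at the start. -/
def run (P : Program) (w : List ℕ) (coins : List Bool) : Cfg :=
  coins.foldl (step P w) ⟨0, fun _ => 0⟩

/-- `P` halts on input `w` after at most `T` steps, whatever the coin tosses. -/
def HaltsWithin (P : Program) (w : List ℕ) (T : ℕ) : Prop :=
  ∀ coins : Fin T → Bool, Halted P (run P w (List.ofFn coins))

/-- The probability, over `T` independent fair coin tosses, that `P` halts and accepts the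
input `w` within `T` steps. -/
def acceptProb (P : Program) (w : List ℕ) (T : ℕ) : ℚ :=
  (Fintype.card {coins : Fin T → Bool // Accepting P (run P w (List.ofFn coins))} : ℚ) / 2 ^ T

end RAM

/-- The input array for the vertex cover problem: the number `n` of vertices, the number `k`, and
the `n * n` entries of the adjacency matrix, row by row. -/
def vertexCoverInput {n : ℕ} (G : SimpleGraph (Fin n)) [DecidableRel G.Adj] (k : ℕ) : List ℕ :=
  n :: k :: List.ofFn fun p : Fin (n * n) => if G.Adj p.divNat p.modNat then 1 else 0

/-- `G` has a vertex cover of size `k`. -/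
def HasVertexCover {n : ℕ} (G : SimpleGraph (Fin n)) (k : ℕ) : Prop :=
  ∃ S : Finset (Fin n), S.card = k ∧ G.IsVertexCover (S : Set (Fin n))

/-! A minimal vertex cover `X` has independent complement, and each of its vertices has a neighbour
outside `X`; so `X` is the union of the neighbourhoods `N v` with `v ∉ X`. It can be built from `∅`
by repeatedly adding some `N v` not contained in the current set `U` (`exists_tight_subset`,
`exists_child_subset`). A search over all such choices branches at most `n` ways. Its depth is at
most the rank: the rows of the adjacency matrix supported in `U` all vanish at a vertex of `N v \
U`, where row `v` is 1, so passing to `U ∪ N v` raises the dimension of their span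
(`rowDim_lt_rowDim_union`). Giving each queued set the weight `(n + 1) ^ (R - f U)`, with `R` the
rank and `f` this dimension, bounds the number of rounds by `(n + 1) ^ R` (`potential_children_lt`);
each round takes polynomial time.

The search tosses no coins, so it accepts with probability 0 or 1. It is written in a structured
language with a step-exact compiler (`Exec.foldl_step`) and verified by Hoare-style rules with time
bounds (`WP`). -/

namespace RAM

/-! ### Structured programs, their compilation and timed Hoare rules -/

/-- Structured programs: straight-line instructions, sequencing, branching on a zero register, and
loops that run as long as a register is nonzero. -/
inductive Cmd : Type
  | skip
  | op (i : Instr)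
  | seq (c d : Cmd)
  | ifz (a : ℕ) (c d : Cmd)
  | loop (a : ℕ) (c : Cmd)

infixr:60 " ;; " => Cmd.seq

/-- The number of instructions in the translation of a structured program. -/
def Cmd.size : Cmd → ℕ
  | .skip => 0
  | .op _ => 1
  | .seq c d => c.size + d.size
  | .ifz _ c d => d.size + c.size + 2
  | .loop _ c => c.size + 2

/-- Translation of a structured program into instructions, the first of which has number `o`. -/
def Cmd.compile : Cmd → ℕ → Program
  | .skip, _ => []
  | .op i, _ => [i]
  | .seq c d, o => c.compile o ++ d.compile (o + c.size)
  | .ifz a c d, o =>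
      .jz a (o + d.size + 2) :: (d.compile (o + 1) ++
        .jump (o + d.size + c.size + 2) :: c.compile (o + d.size + 2))
  | .loop a c, o => .jz a (o + c.size + 2) :: (c.compile (o + 1) ++ [.jump o])

theorem Cmd.length_compile (c : Cmd) (o : ℕ) : (c.compile o).length = c.size := by
  induction c generalizing o <;> simp_all [Cmd.compile, Cmd.size]; omega

/-- `Exec w c s s' t`: on input `w`, the structured program `c` takes the register contents `s` to
`s'` in exactly `t` steps, whatever the coin tosses. -/
inductive Exec (w : List ℕ) : Cmd → (ℕ → ℕ) → (ℕ → ℕ) → ℕ → Prop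
  | skip (s) : Exec w .skip s s 0
  -- Quantifying over `b` excludes coin tosses; quantifying over `o` excludes jumps that are taken.
  | op {i s s'} (h : ∀ b o, i.exec w b ⟨o, s⟩ = ⟨o + 1, s'⟩) : Exec w (.op i) s s' 1
  | seq {c d s s₁ s₂ t₁ t₂} (h₁ : Exec w c s s₁ t₁) (h₂ : Exec w d s₁ s₂ t₂) :
      Exec w (.seq c d) s s₂ (t₁ + t₂)
  | ifz_zero {a c d s s' t} (h : s a = 0) (h₁ : Exec w c s s' t) :
      Exec w (.ifz a c d) s s' (t + 1)
  | ifz_ne {a c d s s' t} (h : s a ≠ 0) (h₁ : Exec w d s s' t) :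
      Exec w (.ifz a c d) s s' (t + 2)
  | loop_zero {a c s} (h : s a = 0) : Exec w (.loop a c) s s 1
  | loop_ne {a c s s₁ s₂ t₁ t₂} (h : s a ≠ 0) (h₁ : Exec w c s s₁ t₁)
      (h₂ : Exec w (.loop a c) s₁ s₂ t₂) : Exec w (.loop a c) s s₂ (t₁ + 2 + t₂)

theorem step_of_getElem? {P : Program} {w : List ℕ} {o : ℕ} {s : ℕ → ℕ} {i : Instr}
    (h : P[o]? = some i) (b : Bool) : step P w ⟨o, s⟩ b = i.exec w b ⟨o, s⟩ := by
  simp [step, h]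

theorem step_append {P pre post : Program} {i : Instr} (hP : P = pre ++ i :: post) (w : List ℕ)
    {o : ℕ} (ho : pre.length = o) (s : ℕ → ℕ) (b : Bool) :
    step P w ⟨o, s⟩ b = i.exec w b ⟨o, s⟩ :=
  step_of_getElem? (by subst hP ho; simp) b

/-- Jump targets are absolute, so the induction needs the code in an arbitrary context `pre`, `post`
with `o` the length of `pre`. -/
theorem Exec.foldl_step {w : List ℕ} {c : Cmd} {s s' : ℕ → ℕ} {t : ℕ} (h : Exec w c s s' t)
    (P pre post : Program) (o : ℕ) (hP : P = pre ++ (c.compile o ++ post)) (ho : pre.length = o)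
    (l : List Bool) (hl : l.length = t) :
    l.foldl (step P w) ⟨o, s⟩ = ⟨o + c.size, s'⟩ := by
  induction h generalizing pre post o l with
  | skip s => simp_all [Cmd.size]
  | op h =>
    obtain ⟨b, rfl⟩ := List.length_eq_one_iff.1 hl
    simp only [List.foldl_cons, List.foldl_nil, Cmd.size]
    rw [step_append (by simpa [Cmd.compile] using hP) w ho, h]
  | @seq c d s s₁ s₂ t₁ t₂ _ _ ih₁ ih₂ =>
    rw [← List.take_append_drop t₁ l, List.foldl_append,
      ih₁ pre (d.compile (o + c.size) ++ post) o (by simpa [Cmd.compile] using hP) ho _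
        (by simp; omega),
      ih₂ (pre ++ c.compile o) post _ (by simpa [Cmd.compile] using hP)
        (by simp [Cmd.length_compile, ho]) _ (by simp; omega)]
    simp [Cmd.size, add_assoc]
  | @ifz_zero a c d s s' t h _ ih =>
    obtain ⟨b, l, rfl⟩ := List.exists_cons_of_length_eq_add_one hl
    rw [List.foldl_cons, step_append (by simpa [Cmd.compile] using hP) w ho]
    simp only [Instr.exec, h, if_true]
    rw [ih (pre ++ .jz a (o + d.size + 2) :: (d.compile (o + 1) ++
        [.jump (o + d.size + c.size + 2)])) post _ (by simpa [Cmd.compile] using hP)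
        (by simp [Cmd.length_compile, ho]; omega) _ (by simpa using hl)]
    simp [Cmd.size]; omega
  | @ifz_ne a c d s s' t h _ ih =>
    obtain ⟨b, l, rfl⟩ := List.exists_cons_of_length_eq_add_one hl
    rw [List.foldl_cons, step_append (by simpa [Cmd.compile] using hP) w ho]
    simp only [Instr.exec, h, if_false]
    rw [← List.take_append_drop t l, List.foldl_append,
      ih (pre ++ [.jz a (o + d.size + 2)]) (.jump (o + d.size + c.size + 2) ::
        (c.compile (o + d.size + 2) ++ post)) _ (by simpa [Cmd.compile] using hP)
        (by simp [ho]) _ (by simp at hl ⊢; omega)]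
    obtain ⟨b', hb⟩ := List.length_eq_one_iff.1 (show (l.drop t).length = 1 by
      simp at hl ⊢; omega)
    rw [hb, List.foldl_cons, List.foldl_nil,
      step_append (pre := pre ++ .jz a (o + d.size + 2) :: d.compile (o + 1))
        (i := .jump (o + d.size + c.size + 2)) (post := c.compile (o + d.size + 2) ++ post)
        (by simpa [Cmd.compile] using hP) w (by simp [Cmd.length_compile, ho]; omega)]
    simp [Instr.exec, Cmd.size]; omega
  | @loop_zero a c s h =>
    obtain ⟨b, rfl⟩ := List.length_eq_one_iff.1 hl
    rw [List.foldl_cons, step_append (by simpa [Cmd.compile] using hP) w ho]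
    simp [Instr.exec, h, Cmd.size]; omega
  | @loop_ne a c s s₁ s₂ t₁ t₂ h _ _ ih₁ ih₂ =>
    obtain ⟨b, l, rfl⟩ := List.exists_cons_of_length_eq_add_one
      (show l.length = (t₁ + 1 + t₂) + 1 by omega)
    rw [List.foldl_cons, step_append (by simpa [Cmd.compile] using hP) w ho]
    simp only [Instr.exec, h, if_false]
    rw [← List.take_append_drop t₁ l, List.foldl_append,
      ih₁ (pre ++ [.jz a (o + c.size + 2)]) (.jump o :: post) _
        (by simpa [Cmd.compile] using hP) (by simp [ho]) _ (by simp at hl ⊢; omega)]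
    obtain ⟨b', l', hb⟩ := List.exists_cons_of_length_eq_add_one
      (show (l.drop t₁).length = t₂ + 1 by simp at hl ⊢; omega)
    rw [hb, List.foldl_cons,
      step_append (pre := pre ++ .jz a (o + c.size + 2) :: c.compile (o + 1))
        (i := .jump o) (post := post)
        (by simpa [Cmd.compile] using hP) w (by simp [Cmd.length_compile, ho]; omega)]
    exact ih₂ pre post o hP ho l' (by
      have := congrArg List.length hb
      simp at hl this; omega)

theorem foldl_step_of_halted {P : Program} {w : List ℕ} {c : Cfg} (h : Halted P c)
    (l : List Bool) : l.foldl (step P w) c = c := by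
  induction l with
  | nil => rfl
  | cons b l ih =>
    have : step P w c b = c := by
      have : P[c.pc]? = none := List.getElem?_eq_none h
      simp [step, this]
    rw [List.foldl_cons, this, ih]

theorem Exec.run_compile {w : List ℕ} {c : Cmd} {s : ℕ → ℕ} {t : ℕ}
    (h : Exec w c (fun _ => 0) s t) (l : List Bool) (hl : t ≤ l.length) :
    run (c.compile 0) w l = ⟨c.size, s⟩ := by
  rw [run, ← List.take_append_drop t l, List.foldl_append,
    h.foldl_step (c.compile 0) [] [] 0 (by simp) rfl _ (by simpa using hl), zero_add]
  exact foldl_step_of_halted (c := ⟨c.size, s⟩) (Cmd.length_compile c 0).le _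

/-- From the register contents `s`, the structured program `c` halts after at most `T` steps with
register contents that satisfy `Q`. -/
def WP (w : List ℕ) (c : Cmd) (T : ℕ) (Q : (ℕ → ℕ) → Prop) (s : ℕ → ℕ) : Prop :=
  ∃ s' t, t ≤ T ∧ Exec w c s s' t ∧ Q s'

namespace WP
variable {w : List ℕ} {Q : (ℕ → ℕ) → Prop} {s : ℕ → ℕ}

theorem mono {c : Cmd} {T T' : ℕ} {Q' : (ℕ → ℕ) → Prop} (h : WP w c T Q s) (hT : T ≤ T')
    (hQ : ∀ s, Q s → Q' s) : WP w c T' Q' s :=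
  let ⟨s', t, ht, he, hq⟩ := h
  ⟨s', t, ht.trans hT, he, hQ _ hq⟩

theorem skip {T : ℕ} (h : Q s) : WP w .skip T Q s := ⟨s, 0, Nat.zero_le _, .skip s, h⟩

theorem seq {c d : Cmd} {T₁ T₂ : ℕ} (h : WP w c T₁ (WP w d T₂ Q) s) :
    WP w (c ;; d) (T₁ + T₂) Q s :=
  let ⟨_, _, h₁, e₁, _, _, h₂, e₂, hq⟩ := h
  ⟨_, _, add_le_add h₁ h₂, .seq e₁ e₂, hq⟩

theorem op_seq {i : Instr} {d : Cmd} {T : ℕ} (h : WP w (.op i) 1 (WP w d T Q) s) :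
    WP w (.op i ;; d) (T + 1) Q s :=
  add_comm 1 T ▸ seq h

theorem const {d v T : ℕ} (h : Q (Function.update s d v)) : WP w (.op (.const d v)) (T + 1) Q s :=
  ⟨_, 1, by omega, .op fun _ _ => rfl, h⟩

theorem add {d a b T : ℕ} (h : Q (Function.update s d (s a + s b))) :
    WP w (.op (.add d a b)) (T + 1) Q s :=
  ⟨_, 1, by omega, .op fun _ _ => rfl, h⟩

theorem sub {d a b T : ℕ} (h : Q (Function.update s d (s a - s b))) :
    WP w (.op (.sub d a b)) (T + 1) Q s :=
  ⟨_, 1, by omega, .op fun _ _ => rfl, h⟩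

theorem load {d a T : ℕ} (h : Q (Function.update s d (s (s a)))) : WP w (.op (.load d a)) (T + 1) Q s :=
  ⟨_, 1, by omega, .op fun _ _ => rfl, h⟩

theorem store {d a T : ℕ} (h : Q (Function.update s (s d) (s a))) :
    WP w (.op (.store d a)) (T + 1) Q s :=
  ⟨_, 1, by omega, .op fun _ _ => rfl, h⟩

theorem read {d a T : ℕ} (h : Q (Function.update s d (w.getD (s a) 0))) :
    WP w (.op (.read d a)) (T + 1) Q s :=
  ⟨_, 1, by omega, .op fun _ _ => rfl, h⟩

theorem ifz {a : ℕ} {c d : Cmd} {T : ℕ} (h₀ : s a = 0 → WP w c T Q s)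
    (h₁ : s a ≠ 0 → WP w d T Q s) : WP w (.ifz a c d) (T + 2) Q s := by
  by_cases h : s a = 0
  · obtain ⟨s', t, ht, e, hq⟩ := h₀ h
    exact ⟨s', _, by omega, .ifz_zero h e, hq⟩
  · obtain ⟨s', t, ht, e, hq⟩ := h₁ h
    exact ⟨s', _, by omega, .ifz_ne h e, hq⟩

/-- A loop with a variant `φ` makes at most `φ` iterations. -/
theorem loop {a : ℕ} {c : Cmd} {T : ℕ} (I : ℕ → (ℕ → ℕ) → Prop)
    (hI : ∀ φ s, I φ s → s a ≠ 0 → WP w c T (fun s' => ∃ φ' < φ, I φ' s') s) (φ : ℕ)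
    (h : I φ s) : WP w (.loop a c) (φ * (T + 2) + 1) (fun s' => s' a = 0 ∧ ∃ φ', I φ' s') s := by
  induction φ using Nat.strong_induction_on generalizing s with
  | _ φ ih =>
    by_cases h0 : s a = 0
    · exact ⟨s, 1, by omega, .loop_zero h0, h0, φ, h⟩
    · obtain ⟨s₁, t₁, h₁, e₁, φ', hlt, hφ'⟩ := hI φ s h h0
      obtain ⟨s₂, t₂, h₂, e₂, hq⟩ := ih φ' hlt hφ'
      refine ⟨s₂, _, ?_, .loop_ne h0 e₁ e₂, hq⟩
      have := Nat.mul_le_mul_right (T + 2) (Nat.succ_le_of_lt hlt)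
      rw [Nat.succ_mul] at this
      omega

/-- A loop that counts register `a` down from `m`. -/
theorem count {a : ℕ} {c : Cmd} {T m : ℕ} (I : ℕ → (ℕ → ℕ) → Prop)
    (ha : ∀ j s, I j s → s a = m - j)
    (hI : ∀ j s, j < m → I j s → WP w c T (I (j + 1)) s) (h : I 0 s) :
    WP w (.loop a c) (m * (T + 2) + 1) (I m) s := by
  -- The variant `φ` counts the rounds left, so `m - φ` rounds are done.
  refine (loop (fun φ s => φ ≤ m ∧ I (m - φ) s) ?_ m ⟨le_rfl, by simpa using h⟩).mono le_rfl ?_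
  · rintro φ s ⟨hφ, hs⟩ h0
    rw [ha _ _ hs] at h0
    refine (hI _ _ (by omega) hs).mono le_rfl fun s' hs' => ⟨φ - 1, by omega, by omega, ?_⟩
    convert hs' using 1
    omega
  · rintro s ⟨h0, φ, hφ, hs⟩
    have := ha _ _ hs
    convert hs using 1
    omega

end WP
end RAM

/-! ### The search program and its effect on memory -/

namespace VertexCover
open RAM Cmd Instr

/-- For the row `U` of the queue and the neighbourhood `N` that the input lists from position `R 6`
on, write the row `U ∪ N` at the address `R 5` and the number of elements of `N \ U` to `R 12`. -/
def unionRow : Cmd :=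
  op (const 12 0) ;; op (add 9 1 17) ;; op (add 10 4 17) ;; op (add 11 5 17) ;;
  loop 9 (
    op (load 14 10) ;; op (read 13 6) ;;
    ifz 14 (op (add 12 12 13)) (op (const 13 1)) ;;
    op (store 11 13) ;; op (add 10 10 3) ;; op (add 11 11 3) ;; op (add 6 6 3) ;; op (sub 9 9 3))

/-- Write the number of elements of the row `U` at the address `R 4` to `R 7`. -/
def countRow : Cmd :=
  op (const 7 0) ;; op (add 9 1 17) ;; op (add 10 4 17) ;;
  loop 9 (op (load 14 10) ;; op (add 7 7 14) ;; op (add 10 10 3) ;; op (sub 9 9 3))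

/-- Append to the queue the unions of its first row `U` with all neighbourhoods that are not
contained in `U`, and make `R 7` nonzero if one of these belongs to a vertex outside `U`. -/
def branch : Cmd :=
  op (const 6 2) ;; op (add 8 1 17) ;; op (add 15 4 17) ;;
  loop 8 (
    unionRow ;;
    ifz 12 skip (op (load 14 15) ;; ifz 14 (op (add 7 7 12)) skip ;; op (add 5 5 1)) ;;
    op (add 15 15 3) ;; op (sub 8 8 3))

/-- Remove the first row from the queue, after branching on it; accept it if it is a cover of size
at most `k`. -/
def process : Cmd :=
  countRow ;; op (sub 7 7 2) ;; branch ;; ifz 7 (op (const 0 1)) skip ;;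
  op (add 4 4 1) ;; op (sub 16 5 4)

/-- The vertex cover algorithm: search through a queue of sets of vertices. The register `R 0`
is the answer, `R 1` and `R 2` hold `n` and `k`, and the queue stretches from address `R 4` to
address `R 5`. -/
def solve : Cmd :=
  op (const 3 1) ;; op (read 1 17) ;; op (read 2 3) ;; op (const 4 32) ;; op (add 5 4 1) ;;
  op (sub 16 5 4) ;; loop 16 process

/-- The addresses from `p` on hold the indicator function of `U` on `{0, …, n - 1}`. -/
def RowAt (n : ℕ) (s : ℕ → ℕ) (p : ℕ) (U : Finset ℕ) : Prop :=
  ∀ j < n, s (p + j) = if j ∈ U then 1 else 0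

/-- The addresses from `p` on hold the rows in the list `L`. -/
def RowsAt (n : ℕ) (s : ℕ → ℕ) : ℕ → List (Finset ℕ) → Prop
  | _, [] => True
  | p, U :: L => RowAt n s p U ∧ RowsAt n s (p + n) L

theorem RowAt.congr {n : ℕ} {s s' : ℕ → ℕ} {p : ℕ} {U : Finset ℕ} (h : RowAt n s p U)
    (hs : ∀ x, p ≤ x → x < p + n → s' x = s x) : RowAt n s' p U := fun j hj => by
  rw [hs _ (by omega) (by omega), h j hj]

theorem RowsAt.congr {n : ℕ} {s s' : ℕ → ℕ} {p : ℕ} {L : List (Finset ℕ)} (h : RowsAt n s p L)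
    (hs : ∀ x, p ≤ x → x < p + L.length * n → s' x = s x) : RowsAt n s' p L := by
  induction L generalizing p with
  | nil => trivial
  | cons U L ih =>
    have : (U :: L).length * n = n + L.length * n := by simp [add_mul, add_comm]
    exact ⟨h.1.congr fun x h₁ h₂ => hs x h₁ (by omega),
      ih h.2 fun x h₁ h₂ => hs x (by omega) (by omega)⟩

theorem rowsAt_append {n : ℕ} {s : ℕ → ℕ} {p : ℕ} {L L' : List (Finset ℕ)} :
    RowsAt n s p (L ++ L') ↔ RowsAt n s p L ∧ RowsAt n s (p + L.length * n) L' := by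
  induction L generalizing p with
  | nil => simp [RowsAt]
  | cons U L ih => simp [RowsAt, ih, and_assoc, add_mul, add_comm n, add_assoc]

/-- The input lists the neighbourhoods `N v` for `v < n`. -/
def Lists (w : List ℕ) (n : ℕ) (N : ℕ → Finset ℕ) : Prop :=
  ∀ v < n, ∀ j < n, w.getD (2 + v * n + j) 0 = if j ∈ N v then 1 else 0

theorem card_filter_le (U : Finset ℕ) (j : ℕ) :
    (U.filter (· ≤ j)).card = (U.filter (· < j)).card + if j ∈ U then 1 else 0 := by
  have : U.filter (· ≤ j) = U.filter (· < j) ∪ U.filter (· = j) := by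
    ext x; simp only [Finset.mem_filter, Finset.mem_union, le_iff_lt_or_eq]; tauto
  rw [this, Finset.card_union_of_disjoint, Finset.filter_eq']
  · split_ifs <;> simp
  · rw [Finset.disjoint_left]; intro x; simp only [Finset.mem_filter]; omega

theorem filter_lt_eq_self {U : Finset ℕ} {n : ℕ} (hU : U ⊆ Finset.range n) :
    U.filter (· < n) = U :=
  Finset.filter_true_of_mem fun _ h => Finset.mem_range.1 (hU h)

variable {w : List ℕ} {n k : ℕ} {N : ℕ → Finset ℕ}

/-- The invariant describes the first `j` columns. Since `R 6` ends at the next row of the input,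
successive calls need no multiplication. Nothing is promised from `t` on except the new row. -/
theorem wp_unionRow (hw : Lists w n N) (hN : ∀ v, N v ⊆ Finset.range n) {s : ℕ → ℕ}
    {U : Finset ℕ} {h t v : ℕ} (hv : v < n) (h1 : s 1 = n) (h3 : s 3 = 1) (h17 : s 17 = 0)
    (h4 : s 4 = h) (h5 : s 5 = t) (h6 : s 6 = 2 + v * n) (hU : RowAt n s h U) (hh : 32 ≤ h)
    (ht : h + n ≤ t) :
    WP w unionRow (12 * n + 5) (fun s' => s' 6 = 2 + (v + 1) * n ∧ s' 12 = (N v \ U).card ∧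
      RowAt n s' t (U ∪ N v) ∧
      ∀ x < t, x < 6 ∨ x = 7 ∨ x = 8 ∨ 15 ≤ x → s' x = s x) s := by
  -- Queue addresses start at 32 and never collide with the working registers.
  have hlt : ∀ c j, c < 32 → (c = t + j) = False := fun c j hc => by simp; omega
  unfold unionRow
  refine .op_seq (.const ?_)
  refine .op_seq (.add ?_)
  refine .op_seq (.add ?_)
  refine .op_seq (.add ?_)
  refine WP.mono (WP.count (m := n) (T := 10) (fun j s' =>
    s' 9 = n - j ∧ s' 10 = h + j ∧ s' 11 = t + j ∧ s' 6 = 2 + v * n + j ∧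
    s' 12 = ((N v \ U).filter (· < j)).card ∧ (∀ i < j, s' (t + i) = if i ∈ U ∪ N v then 1 else 0) ∧
    ∀ x < t, x < 6 ∨ x = 7 ∨ x = 8 ∨ 15 ≤ x → s' x = s x) ?_ ?_ ?_) (by omega) ?_
  · intro j s' hs; exact hs.1
  · rintro j s' hj ⟨h9, h10, h11, h6', h12, hrow, hfr⟩
    have h3' : s' 3 = 1 := by rw [hfr 3 (by omega) (by omega), h3]
    have hUj : s' (h + j) = if j ∈ U then 1 else 0 := by
      rw [hfr _ (by omega) (by omega), hU j hj]
    have hwj := hw v hv j hj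
    refine .op_seq (.load ?_)
    refine .op_seq (.read ?_)
    refine .seq (T₁ := 3) (T₂ := 5) (.ifz (fun h0 => .add ?_) (fun h0 => .const ?_)) <;>
    · refine .op_seq (.store ?_)
      refine .op_seq (.add ?_)
      refine .op_seq (.add ?_)
      refine .op_seq (.add ?_)
      refine .sub ?_
      simp [Function.update_apply, h10, h6', hUj, hwj, h11, hlt, h3', h9, h12,
        card_filter_le, -List.getD_eq_getElem?_getD] at h0 ⊢
      refine ⟨by omega, by omega, by omega, by omega, by simp [h0], ?_, ?_⟩
      · intro i hi
        have : ∀ c < 32, t + i ≠ c := fun c hc => by omega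
        rcases hi.lt_or_eq with hi | rfl
        · simp [this, hi.ne, hrow i hi]
        · simp [this, h0]
      · intro x hx hx'
        have : ∀ c, 9 ≤ c → c < 15 → x ≠ c := fun c h₁ h₂ => by omega
        have h₁ : x ≠ t + j := by omega
        have h₂ : x ≠ 6 := by omega
        simp [this, h₁, h₂, hfr x hx hx']
  · simp [Function.update_apply, h1, h17, h4, h5, h6]
    intro x hx hx'
    have : ∀ c, 9 ≤ c → c < 15 → x ≠ c := fun c h₁ h₂ => by omega
    simp [this]
  · rintro s' ⟨-, -, -, h6', h12, hrow, hfr⟩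
    rw [filter_lt_eq_self (Finset.sdiff_subset.trans (hN v))] at h12
    exact ⟨by rw [h6']; ring, h12, hrow, hfr⟩

theorem wp_countRow {s : ℕ → ℕ} {U : Finset ℕ} {h : ℕ} (hn : U ⊆ Finset.range n) (h1 : s 1 = n)
    (h3 : s 3 = 1) (h17 : s 17 = 0) (h4 : s 4 = h) (hU : RowAt n s h U) (hh : 32 ≤ h) :
    WP w countRow (6 * n + 4) (fun s' => s' 7 = U.card ∧
      ∀ x, x < 7 ∨ 15 ≤ x → s' x = s x) s := by
  unfold countRow
  refine .op_seq (.const ?_)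
  refine .op_seq (.add ?_)
  refine .op_seq (.add ?_)
  refine WP.mono (WP.count (m := n) (T := 4) (fun j s' =>
    s' 9 = n - j ∧ s' 10 = h + j ∧ s' 7 = (U.filter (· < j)).card ∧
    ∀ x, x < 7 ∨ 15 ≤ x → s' x = s x) ?_ ?_ ?_) (by omega) ?_
  · intro j s' hs; exact hs.1
  · rintro j s' hj ⟨h9, h10, h7, hfr⟩
    have h3' : s' 3 = 1 := by rw [hfr 3 (by omega), h3]
    have hUj : s' (h + j) = if j ∈ U then 1 else 0 := by rw [hfr _ (by omega), hU j hj]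
    refine .op_seq (.load ?_)
    refine .op_seq (.add ?_)
    refine .op_seq (.add ?_)
    refine .sub ?_
    simp [Function.update_apply, h10, hUj, h3', h9, h7, card_filter_le]
    refine ⟨by omega, by omega, ?_⟩
    intro x hx
    have : ∀ c, 7 ≤ c → c < 15 → x ≠ c := fun c h₁ h₂ => by omega
    simp [this, hfr x hx]
  · simp [Function.update_apply, h1, h17, h4]
    intro x hx
    have : ∀ c, 7 ≤ c → c < 15 → x ≠ c := fun c h₁ h₂ => by omega
    simp [this]
  · rintro s' ⟨-, -, h7, hfr⟩
    rw [filter_lt_eq_self hn] at h7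
    exact ⟨h7, hfr⟩

/-- `U` contains the neighbourhoods of the vertices outside `U`. -/
def Covers (n : ℕ) (N : ℕ → Finset ℕ) (U : Finset ℕ) : Prop := ∀ i < n, i ∉ U → N i ⊆ U

/-- The unions of `U` with those of the sets `N 0, …, N (v - 1)` that are not contained in `U`. -/
def children (N : ℕ → Finset ℕ) (U : Finset ℕ) : ℕ → List (Finset ℕ)
  | 0 => []
  | v + 1 => children N U v ++ if N v ⊆ U then [] else [U ∪ N v]

/-- Each union is written at the tail, but the tail moves past it only if `N v \ U` is nonempty;
otherwise it is overwritten. `R 7` only grows, by `(N v \ U).card` for each `v ∉ U`, so it stays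
zero exactly when no edge is left uncovered. -/
theorem wp_branch (hw : Lists w n N) (hN : ∀ v, N v ⊆ Finset.range n) {s : ℕ → ℕ}
    {U : Finset ℕ} {h t : ℕ} (h1 : s 1 = n) (h3 : s 3 = 1) (h17 : s 17 = 0)
    (h4 : s 4 = h) (h5 : s 5 = t) (hU : RowAt n s h U) (hh : 32 ≤ h) (ht : h + n ≤ t) :
    WP w branch (n * (12 * n + 20) + 4) (fun s' =>
      s' 5 = t + (children N U n).length * n ∧ RowsAt n s' t (children N U n) ∧
      (s' 7 = 0 ↔ s 7 = 0 ∧ Covers n N U) ∧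
      ∀ x < t, x < 5 ∨ 16 ≤ x → s' x = s x) s := by
  unfold branch
  refine .op_seq (.const ?_)
  refine .op_seq (.add ?_)
  refine .op_seq (.add ?_)
  refine WP.mono (WP.count (m := n) (T := 12 * n + 18) (fun v s' =>
    s' 8 = n - v ∧ s' 15 = h + v ∧ s' 6 = 2 + v * n ∧
    s' 5 = t + (children N U v).length * n ∧ RowsAt n s' t (children N U v) ∧
    (s' 7 = 0 ↔ s 7 = 0 ∧ ∀ i < v, i ∉ U → N i ⊆ U) ∧
    ∀ x < t, x < 5 ∨ 16 ≤ x → s' x = s x) ?_ ?_ ?_) (by simp [add_assoc]) ?_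
  · intro j s' hs; exact hs.1
  · rintro v s' hv ⟨h8, h15, h6, h5', hrows, h7, hfr⟩
    have fr : ∀ {c x}, s x = c → x < t → x < 5 ∨ 16 ≤ x → s' x = c :=
      fun h hx hx' => (hfr _ hx hx').trans h
    have hU' : RowAt n s' h U := hU.congr fun x _ _ => hfr x (by omega) (by omega)
    refine .seq (T₁ := 12 * n + 5) (T₂ := 13) ?_
    refine (wp_unionRow hw hN hv (fr h1 (by omega) (by omega)) (fr h3 (by omega) (by omega))
      (fr h17 (by omega) (by omega)) (fr h4 (by omega) (by omega)) h5' h6 hU' hh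
      (by omega)).mono le_rfl ?_
    rintro s₁ ⟨h6₁, h12₁, hrow₁, hfr₁⟩
    have hrows₁ : RowsAt n s₁ t (children N U v) :=
      hrows.congr fun x _ hx => hfr₁ x hx (by omega)
    have fr₁ : ∀ {c x}, s' x = c → x < t → x < 6 ∨ x = 7 ∨ x = 8 ∨ 15 ≤ x → s₁ x = c :=
      fun h hx hx' => (hfr₁ _ (by omega) hx').trans h
    have h3₁ : s₁ 3 = 1 := fr₁ (fr h3 (by omega) (by omega)) (by omega) (by omega)
    have h1₁ : s₁ 1 = n := fr₁ (fr h1 (by omega) (by omega)) (by omega) (by omega)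
    have h5₁ := fr₁ h5' (by omega) (by omega)
    have h8₁ := fr₁ h8 (by omega) (by omega)
    have h15₁ := fr₁ h15 (by omega) (by omega)
    have h7₁ := fr₁ (x := 7) rfl (by omega) (by omega)
    have hv₁ : s₁ (h + v) = if v ∈ U then 1 else 0 := by
      rw [hfr₁ _ (by omega) (by omega), hU' v hv]
    rw [← h7₁] at h7
    have hfr' : ∀ x < t, x < 5 ∨ 16 ≤ x → s₁ x = s x := fun x hx hx' => by
      rw [hfr₁ x (by omega) (by omega), hfr x hx hx']
    have hsplit : (∀ i ≤ v, i ∉ U → N i ⊆ U) ↔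
        (∀ i < v, i ∉ U → N i ⊆ U) ∧ (v ∉ U → N v ⊆ U) := by
      simp only [le_iff_lt_or_eq, or_imp, forall_and, forall_eq]
    have h12 : s₁ 12 = 0 ↔ N v ⊆ U := by
      rw [h12₁, Finset.card_eq_zero, Finset.sdiff_eq_empty_iff_subset]
    -- The end of the loop body, common to all three ways through the conditionals.
    have finish : ∀ s₂ : ℕ → ℕ, s₂ 8 = s₁ 8 → s₂ 15 = s₁ 15 → s₂ 6 = s₁ 6 → s₂ 3 = 1 →
        s₂ 5 = t + (children N U (v + 1)).length * n → RowsAt n s₂ t (children N U (v + 1)) →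
        (s₂ 7 = 0 ↔ s₁ 7 = 0 ∧ (v ∉ U → N v ⊆ U)) →
        (∀ x < t, x < 5 ∨ 16 ≤ x → s₂ x = s₁ x) →
        WP w (op (.add 15 15 3) ;; op (.sub 8 8 3)) 2 (fun s' =>
          s' 8 = n - (v + 1) ∧ s' 15 = h + (v + 1) ∧ s' 6 = 2 + (v + 1) * n ∧
          s' 5 = t + (children N U (v + 1)).length * n ∧ RowsAt n s' t (children N U (v + 1)) ∧
          (s' 7 = 0 ↔ s 7 = 0 ∧ ∀ i < v + 1, i ∉ U → N i ⊆ U) ∧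
          ∀ x < t, x < 5 ∨ 16 ≤ x → s' x = s x) s₂ := by
      intro s₂ e8 e15 e6 e3 e5 erows e7 efr
      refine .op_seq (.add ?_)
      refine .sub ?_
      refine ⟨?_, ?_, ?_, ?_, erows.congr ?_, ?_, ?_⟩
      · simp [e8, e3, h8₁]; omega
      · simp [e15, e3, h15₁]; omega
      · simp [e6, h6₁]
      · simp [e5]
      · intro x hx _
        have : ∀ c < 32, x ≠ c := fun c h₁ => by omega
        simp [this]
      · simp [e7, h7, hsplit, and_assoc]
      · intro x hx hx'
        have : ∀ c, 5 ≤ c → c < 16 → x ≠ c := fun c h₁ h₂ => by omega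
        simp [this, efr x hx hx', hfr' x hx hx']
    refine .seq (T₁ := 11) (T₂ := 2) (.ifz (fun h0 => .skip ?_) (fun h0 => ?_))
    · have hc : children N U (v + 1) = children N U v := by simp [children, h12.1 h0]
      exact finish s₁ rfl rfl rfl h3₁ (by rw [hc, h5₁]) (by rwa [hc]) (by simp [h12.1 h0])
        fun _ _ _ => rfl
    · have hc : children N U (v + 1) = children N U v ++ [U ∪ N v] := by
        simp [children, mt h12.2 h0]
      have hlen : (children N U (v + 1)).length * n = (children N U v).length * n + n := by
        rw [hc]; simp [add_mul]
      refine .op_seq (.load ?_)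
      have hrows₂ : RowsAt n s₁ t (children N U (v + 1)) := by
        rw [hc, rowsAt_append]
        exact ⟨hrows₁, hrow₁, trivial⟩
      refine .seq (T₁ := 3) (T₂ := 5) (.ifz (fun hz => .add ?_) (fun hz => .skip ?_))
      all_goals
        refine .add (finish _ ?_ ?_ ?_ ?_ ?_ (hrows₂.congr ?_) ?_ ?_)
        · simp
        · simp
        · simp
        · simp [h3₁]
        · simp [h5₁, h1₁, hlen]; omega
        · intro x hx _
          have : ∀ c < 32, x ≠ c := fun c h₁ => by omega
          simp [this]
        · simp [h15₁, hv₁] at hz ⊢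
          simp [hz, h12]
        · intro x hx hx'
          have : ∀ c, 5 ≤ c → c < 16 → x ≠ c := fun c h₁ h₂ => by omega
          simp [this]
  · refine ⟨?_, ?_, ?_, ?_, trivial, ?_, ?_⟩
    iterate 5 simp [h1, h17, h4, h5, children]
    intro x hx hx'
    have : ∀ c, 5 ≤ c → c < 16 → x ≠ c := fun c h₁ h₂ => by omega
    simp [this]
  · rintro s' ⟨-, -, -, h5', hrows, h7, hfr⟩
    exact ⟨h5', hrows, h7, hfr⟩

/-- The registers of the vertex cover algorithm hold `n`, `k`, and the queue `L`. -/
structure Holds (n k : ℕ) (L : List (Finset ℕ)) (s : ℕ → ℕ) : Prop where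
  size : s 1 = n
  target : s 2 = k
  one : s 3 = 1
  zero : s 17 = 0
  le_head : 32 ≤ s 4
  tail : s 5 = s 4 + L.length * n
  pending : s 16 = L.length * n
  rows : RowsAt n s (s 4) L

open Classical in
theorem wp_process (hw : Lists w n N) (hN : ∀ v, N v ⊆ Finset.range n) {s : ℕ → ℕ}
    {U : Finset ℕ} {L : List (Finset ℕ)} (hU : U ⊆ Finset.range n) (hs : Holds n k (U :: L) s) :
    WP w process (n * (12 * n + 26) + 14) (fun s' => Holds n k (L ++ children N U n) s' ∧
      s' 0 = if U.card ≤ k ∧ Covers n N U then 1 else s 0) s := by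
  obtain ⟨h1, h2, h3, h17, hh, h5, -, hrow, hrows⟩ := hs
  have hlen : (U :: L).length * n = n + L.length * n := by simp [add_mul, add_comm]
  rw [hlen] at h5
  unfold process
  refine (WP.seq (T₁ := 6 * n + 4) (T₂ := n * (12 * n + 20) + 10) ?_).mono (by
    simp only [mul_add]; omega) fun _ h => h
  refine (wp_countRow hU h1 h3 h17 rfl hrow hh).mono le_rfl ?_
  rintro s₁ ⟨h7, hfr⟩
  refine .op_seq (.sub ?_)
  set s₂ := Function.update s₁ 7 (s₁ 7 - s₁ 2) with hs₂
  have hfr₂ : ∀ x, x < 7 ∨ 15 ≤ x → s₂ x = s x := fun x hx => by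
    rw [hs₂, Function.update_of_ne (by omega), hfr x hx]
  -- Truncated subtraction serves as the comparison with `k`.
  have h7₂ : s₂ 7 = 0 ↔ U.card ≤ k := by
    simp [hs₂, h7, hfr 2, h2, Nat.sub_eq_zero_iff_le]
  refine .seq (T₁ := n * (12 * n + 20) + 4) (T₂ := 5) ?_
  refine (wp_branch hw hN ((hfr₂ 1 (by omega)).trans h1) ((hfr₂ 3 (by omega)).trans h3)
    ((hfr₂ 17 (by omega)).trans h17) (hfr₂ 4 (by omega)) ((hfr₂ 5 (by omega)).trans h5)
    (hrow.congr fun x _ _ => hfr₂ x (by omega)) hh (by omega)).mono le_rfl ?_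
  rintro s₃ ⟨h5₃, hrows₃, h7₃, hfr₃⟩
  rw [h7₂] at h7₃
  have hfr' : ∀ x < s 4 + (n + L.length * n), x < 5 ∨ 16 ≤ x → s₃ x = s x := fun x hx hx' => by
    rw [hfr₃ x hx hx', hfr₂ x (by omega)]
  have finish : ∀ s₄ : ℕ → ℕ, (∀ x, x ≠ 0 → s₄ x = s₃ x) →
      (s₄ 0 = if U.card ≤ k ∧ Covers n N U then 1 else s 0) →
      WP w (op (.add 4 4 1) ;; op (.sub 16 5 4)) 2 (fun s' =>
        Holds n k (L ++ children N U n) s' ∧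
        s' 0 = if U.card ≤ k ∧ Covers n N U then 1 else s 0) s₄ := by
    intro s₄ e e0
    have e' : ∀ {c} x, s x = c → x ≠ 0 → x < 32 → x < 5 ∨ 16 ≤ x → s₄ x = c :=
      fun x hc h₀ h₁ h₂ => by rw [e x h₀, hfr' x (by omega) h₂, hc]
    have e4 := e' 4 rfl (by omega) (by omega) (by omega)
    have e1 := e' 1 h1 (by omega) (by omega) (by omega)
    have e5 := (e 5 (by omega)).trans h5₃
    refine .op_seq (.add ?_)
    refine .sub ?_
    refine ⟨⟨?_, ?_, ?_, ?_, ?_, ?_, ?_, ?_⟩, ?_⟩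
    · simp [e1]
    · simp [e' 2 h2]
    · simp [e' 3 h3]
    · simp [e' 17 h17]
    · simp [e4]; omega
    · simp [e4, e5, e1, add_mul]; omega
    · simp [e4, e5, e1, add_mul]; omega
    · have hx : ∀ x, 32 ≤ x → ∀ c < 32, x ≠ c := fun x h₀ c h₁ => by omega
      have : Function.update (Function.update s₄ 4 (s₄ 4 + s₄ 1)) 16
          (Function.update s₄ 4 (s₄ 4 + s₄ 1) 5 - Function.update s₄ 4 (s₄ 4 + s₄ 1) 4) 4 =
          s 4 + n := by simp [e4, e1]
      rw [this, rowsAt_append]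
      constructor
      · refine hrows.congr fun x h₁ h₂ => ?_
        simp [hx x (by omega), e, hfr' x (by omega) (by omega)]
      · rw [add_assoc]
        refine hrows₃.congr fun x h₁ h₂ => ?_
        simp [hx x (by omega), e]
    · simp [e0]
  refine .seq (T₁ := 3) (T₂ := 2) (.ifz (fun h0 => .const ?_) (fun h0 => .skip ?_))
  · refine finish _ (fun x hx => by simp [hx]) ?_
    simp only [Function.update_self]
    rw [if_pos (h7₃.1 h0)]
  · refine finish _ (fun x hx => rfl) ?_
    rw [if_neg (mt h7₃.2 h0), hfr' 0 (by omega) (by omega)]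

end VertexCover

/-! ### Termination and correctness of the search -/

namespace VertexCover
open RAM Cmd Instr
variable {w : List ℕ} {n k : ℕ} {N : ℕ → Finset ℕ}

theorem mem_children {U Z : Finset ℕ} {m : ℕ} :
    Z ∈ children N U m ↔ ∃ v < m, ¬ N v ⊆ U ∧ Z = U ∪ N v := by
  induction m with
  | zero => simp [children]
  | succ m ih =>
    simp only [children, List.mem_append, ih, Nat.lt_succ_iff_lt_or_eq, or_and_right, exists_or,
      exists_eq_left]
    split_ifs with h <;> simp [h]

/-- A bound on the number of steps of the search from the queue `L`, if the number `f U` for the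
rows `U` grows along every branch and never exceeds `R`. -/
def potential (n R : ℕ) (f : Finset ℕ → ℕ) (L : List (Finset ℕ)) : ℕ :=
  (L.map fun U => (n + 1) ^ (R - f U)).sum

theorem potential_append {R : ℕ} {f : Finset ℕ → ℕ} (L L' : List (Finset ℕ)) :
    potential n R f (L ++ L') = potential n R f L + potential n R f L' := by
  simp [potential]

/-- There are at most `n` children, and each weighs at most `1 / (n + 1)` of its parent because `f`
grows. The bound `hR` keeps the subtraction in the exponent from truncating. -/
theorem potential_children_lt {R : ℕ} {f : Finset ℕ → ℕ} (hR : ∀ U, f U ≤ R)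
    (hf : ∀ U, ∀ v < n, ¬ N v ⊆ U → f U < f (U ∪ N v)) (U : Finset ℕ) :
    potential n R f (children N U n) < (n + 1) ^ (R - f U) := by
  have key : ∀ m ≤ n, potential n R f (children N U m) * (n + 1) ≤ m * (n + 1) ^ (R - f U) := by
    intro m hm
    induction m with
    | zero => simp [children, potential]
    | succ m ih =>
      rw [children, potential_append, add_mul, add_mul]
      refine add_le_add (ih (by omega)) ?_
      split_ifs with h
      · simp [potential]
      · have h₁ := hf U m (by omega) h
        have h₂ := hR (U ∪ N m)
        simp only [potential, List.map_cons, List.map_nil, List.sum_cons, List.sum_nil, add_zero,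
          one_mul, ← pow_succ]
        exact Nat.pow_le_pow_right (by omega) (by omega)
  refine lt_of_mul_lt_mul_right ((key n le_rfl).trans_lt ?_) (Nat.zero_le (n + 1))
  rw [mul_comm]
  exact Nat.mul_lt_mul_of_pos_left (Nat.lt_succ_self n) (by positivity)

/-- Every element of `X` is in the neighbourhood of a vertex outside `X`. -/
def Tight (n : ℕ) (N : ℕ → Finset ℕ) (X : Finset ℕ) : Prop := ∀ u ∈ X, ∃ v < n, v ∉ X ∧ u ∈ N v

/-- A vertex of `X \ U` has a neighbour `v ∉ X`, whose whole neighbourhood lies in `X` since `X` is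
a cover. -/
theorem exists_child_subset {U X : Finset ℕ} (hX : Covers n N X) (hX' : Tight n N X)
    (hU : U ⊆ X) (hne : U ≠ X) : ∃ Z ∈ children N U n, Z ⊆ X := by
  obtain ⟨u, huX, huU⟩ := Finset.exists_of_ssubset (hU.ssubset_of_ne hne)
  obtain ⟨v, hv, hvX, huv⟩ := hX' u huX
  exact ⟨_, mem_children.2 ⟨v, hv, fun h => huU (h huv), rfl⟩, Finset.union_subset hU (hX v hv hvX)⟩

/-- The invariant of the search: its state, and what it says about the answer. -/
structure SearchInv (n k : ℕ) (N : ℕ → Finset ℕ) (L : List (Finset ℕ)) (s : ℕ → ℕ) : Prop where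
  holds : Holds n k L s
  subset : ∀ U ∈ L, U ⊆ Finset.range n
  sound : s 0 = 1 → ∃ U : Finset ℕ, U.card ≤ k ∧ Covers n N U
  complete : ∀ X, X.card ≤ k → Covers n N X → Tight n N X → s 0 = 1 ∨ ∃ U ∈ L, U ⊆ X

theorem wp_process_searchInv (hw : Lists w n N) (hN : ∀ v, N v ⊆ Finset.range n) {s : ℕ → ℕ}
    {U : Finset ℕ} {L : List (Finset ℕ)} (hs : SearchInv n k N (U :: L) s) :
    WP w process (n * (12 * n + 26) + 14) (SearchInv n k N (L ++ children N U n)) s := by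
  have hU := hs.subset U (by simp)
  refine (wp_process hw hN hU hs.holds).mono le_rfl fun s' ⟨h, h0⟩ => ⟨h, ?_, ?_, ?_⟩
  · intro Z hZ
    rcases List.mem_append.1 hZ with hZ | hZ
    · exact hs.subset Z (by simp [hZ])
    · obtain ⟨v, -, -, rfl⟩ := mem_children.1 hZ
      exact Finset.union_subset hU (hN v)
  · intro h1
    split_ifs at h0 with hc
    · exact ⟨U, hc⟩
    · exact hs.sound (h0 ▸ h1)
  · intro X hk hX hX'
    split_ifs at h0 with hc
    · exact .inl h0
    · refine (hs.complete X hk hX hX').imp h0.trans ?_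
      rintro ⟨Z, hZ, hZX⟩
      rcases List.mem_cons.1 hZ with rfl | hZ
      -- The removed row can be passed on to a child inside `X`: it is not `X` itself, as it would
      -- have been accepted.
      · obtain ⟨Y, hY, hYX⟩ := exists_child_subset hX hX' hZX (by rintro rfl; exact hc ⟨hk, hX⟩)
        exact ⟨Y, by simp [hY], hYX⟩
      · exact ⟨Z, by simp [hZ], hZX⟩

/-- The potential of the queue is the loop variant. The final 7 pays for six initial instructions
and the last loop test. -/
theorem wp_solve (hn : 1 ≤ n) (hwn : w.getD 0 0 = n) (hwk : w.getD 1 0 = k) (hw : Lists w n N)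
    (hN : ∀ v, N v ⊆ Finset.range n) {R : ℕ} {f : Finset ℕ → ℕ} (hR : ∀ U, f U ≤ R)
    (hf : ∀ U, ∀ v < n, ¬ N v ⊆ U → f U < f (U ∪ N v)) :
    WP w solve ((n + 1) ^ R * (n * (12 * n + 26) + 16) + 7) (fun s =>
      (s 0 = 1 → ∃ U : Finset ℕ, U.card ≤ k ∧ Covers n N U) ∧
      ∀ X, X.card ≤ k → Covers n N X → Tight n N X → s 0 = 1) (fun _ => 0) := by
  unfold solve
  refine .op_seq (.const ?_)
  refine .op_seq (.read ?_)
  refine .op_seq (.read ?_)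
  refine .op_seq (.const ?_)
  refine .op_seq (.add ?_)
  refine .op_seq (.sub ?_)
  refine (WP.loop (T := n * (12 * n + 26) + 14)
    (fun φ s => ∃ L, φ = potential n R f L ∧ SearchInv n k N L s) ?_ ((n + 1) ^ (R - f ∅)) ?_).mono
    ?_ ?_
  · rintro _ s ⟨L, rfl, hs⟩ h0
    cases L with
    | nil => exact absurd (by simpa using hs.holds.pending) h0
    | cons U L =>
      refine (wp_process_searchInv hw hN hs).mono le_rfl fun s' hs' => ⟨_, ?_, _, rfl, hs'⟩
      have := potential_children_lt hR hf U
      have hc : potential n R f (U :: L) = (n + 1) ^ (R - f U) + potential n R f L := by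
        simp [potential]
      rw [potential_append, hc]
      omega
  · refine ⟨[∅], by simp [potential], ⟨?_, ?_, ?_, ?_, ?_, ?_, ?_, ?_⟩, ?_, ?_, ?_⟩
    any_goals simp [hwn, hwk, -List.getD_eq_getElem?_getD]
    -- Untouched memory is zero, which already encodes the row `∅`.
    refine ⟨fun j _ => ?_, trivial⟩
    have : ∀ c < 32, 32 + j ≠ c := fun c h₁ => by omega
    simp [this]
  · have := Nat.mul_le_mul_right (n * (12 * n + 26) + 16)
      (Nat.pow_le_pow_right (show 0 < n + 1 by omega) (Nat.sub_le R (f ∅)))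
    rw [show n * (12 * n + 26) + 14 + 2 = n * (12 * n + 26) + 16 from rfl]
    omega
  · rintro s ⟨h0, -, L, -, hs⟩
    refine ⟨hs.sound, fun X hk hX hX' => (hs.complete X hk hX hX').resolve_right ?_⟩
    rintro ⟨U, hU, -⟩
    have h16 := hs.holds.pending
    -- The loop stops at queue length 0 in memory; this means no rows only because `n ≠ 0`.
    rw [h0, eq_comm, mul_eq_zero, List.length_eq_zero_iff] at h16
    rcases h16 with rfl | rfl
    · simp at hU
    · omega

/-- Delete vertices while the set remains a cover. Once no `u` can be deleted, deleting it uncovers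
an edge, whose other end must lie outside the set. -/
theorem exists_tight_subset (hirr : ∀ v, v ∉ N v)
    (hsymm : ∀ u v, u ∈ N v → v < n ∧ u < n ∧ v ∈ N u) (S : Finset ℕ) (hS : Covers n N S)
    (hSn : S ⊆ Finset.range n) : ∃ X ⊆ S, Covers n N X ∧ Tight n N X := by
  induction hc : S.card using Nat.strong_induction_on generalizing S with
  | _ m ih =>
    by_cases h : ∃ u ∈ S, Covers n N (S.erase u)
    · obtain ⟨u, hu, hcov⟩ := h
      obtain ⟨X, hX, h⟩ := ih _ (hc ▸ Finset.card_erase_lt_of_mem hu) (S.erase u) hcov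
        ((Finset.erase_subset _ _).trans hSn) rfl
      exact ⟨X, hX.trans (Finset.erase_subset _ _), h⟩
    · push Not at h
      refine ⟨S, Finset.Subset.refl S, hS, fun u hu => ?_⟩
      have hu' := h u hu
      simp only [Covers, not_forall] at hu'
      obtain ⟨v, hv, hvS, hsub⟩ := hu'
      obtain ⟨j, hj, hjS⟩ := Finset.not_subset.1 hsub
      by_cases hvS' : v ∈ S
      · obtain rfl : v = u := by
          by_contra hne
          exact hvS (Finset.mem_erase.2 ⟨hne, hvS'⟩)
        have hjv : j ≠ v := by rintro rfl; exact hirr _ hj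
        exact ⟨j, (hsymm _ _ hj).2.1, fun h => hjS (Finset.mem_erase.2 ⟨hjv, h⟩),
          (hsymm _ _ hj).2.2⟩
      · have hjS' := hS v hv hvS' hj
        obtain rfl : j = u := by
          by_contra hne
          exact hjS (Finset.mem_erase.2 ⟨hne, hjS'⟩)
        exact ⟨v, hv, hvS', hj⟩

/-! ### Neighbourhoods, rank and vertex covers of a graph -/

section Graph
variable (G : SimpleGraph (Fin n))

open Classical in
/-- The neighbourhood of `v` in `G`, as a set of natural numbers. -/
noncomputable def nbhd (v : ℕ) : Finset ℕ :=
  (Finset.range n).filter fun j => ∃ (hv : v < n) (hj : j < n), G.Adj ⟨v, hv⟩ ⟨j, hj⟩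

theorem mem_nbhd {v j : ℕ} :
    j ∈ nbhd G v ↔ ∃ (hv : v < n) (hj : j < n), G.Adj ⟨v, hv⟩ ⟨j, hj⟩ := by
  simp only [nbhd, Finset.mem_filter, Finset.mem_range]
  exact ⟨And.right, fun h => ⟨h.2.1, h⟩⟩

theorem nbhd_subset (v : ℕ) : nbhd G v ⊆ Finset.range n := by
  classical
  exact Finset.filter_subset _ _

theorem val_mem_nbhd {v j : Fin n} : (j : ℕ) ∈ nbhd G v ↔ G.Adj v j := by
  simp [mem_nbhd]

theorem lists_vertexCoverInput [DecidableRel G.Adj] (k : ℕ) :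
    Lists (vertexCoverInput G k) n (nbhd G) := by
  intro v hv j hj
  have hlt : v * n + j < n * n := by nlinarith
  have hd : (v * n + j) / n = v := by
    rw [mul_comm, Nat.mul_add_div (by omega), Nat.div_eq_of_lt hj, add_zero]
  have hm : (v * n + j) % n = j := by rw [mul_comm, Nat.mul_add_mod, Nat.mod_eq_of_lt hj]
  have e : 2 + v * n + j = (v * n + j) + 1 + 1 := by ring
  have hadj : G.Adj (Fin.divNat ⟨v * n + j, hlt⟩) (Fin.modNat ⟨v * n + j, hlt⟩) ↔
      j ∈ nbhd G v := by
    rw [← val_mem_nbhd]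
    simp [hd, hm]
  rw [vertexCoverInput, e]
  simp [hlt, hadj]

/-- The dimension of the span of the rows of the adjacency matrix that are supported in `U`. -/
noncomputable def rowDim [DecidableRel G.Adj] (U : Finset ℕ) : ℕ :=
  Module.finrank ℝ (Submodule.span ℝ {x | ∃ v : Fin n, nbhd G v ⊆ U ∧ G.adjMatrix ℝ v = x})

theorem rowDim_le_rank [DecidableRel G.Adj] (U : Finset ℕ) :
    rowDim G U ≤ (G.adjMatrix ℝ).rank := by
  rw [Matrix.rank_eq_finrank_span_row]
  refine Submodule.finrank_mono (Submodule.span_mono ?_)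
  rintro _ ⟨v, -, rfl⟩
  exact ⟨v, rfl⟩

/-- For `j ∈ N v \ U`, the `j`-th coordinate vanishes on the smaller span but not on row `v`, which
lies in the larger one. -/
theorem rowDim_lt_rowDim_union [DecidableRel G.Adj] {U : Finset ℕ} {v : ℕ} (hv : v < n)
    (h : ¬ nbhd G v ⊆ U) : rowDim G U < rowDim G (U ∪ nbhd G v) := by
  obtain ⟨j, hj, hjU⟩ := Finset.not_subset.1 h
  obtain ⟨_, hjn, hadj⟩ := (mem_nbhd G).1 hj
  refine Submodule.finrank_lt_finrank_of_lt (lt_of_le_of_ne (Submodule.span_mono ?_) fun heq => ?_)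
  · rintro _ ⟨u, hu, rfl⟩
    exact ⟨u, hu.trans Finset.subset_union_left, rfl⟩
  · have hmem : G.adjMatrix ℝ ⟨v, hv⟩ ∈
        Submodule.span ℝ {x | ∃ v : Fin n, nbhd G v ⊆ U ∧ G.adjMatrix ℝ v = x} := by
      rw [heq]
      exact Submodule.subset_span ⟨⟨v, hv⟩, Finset.subset_union_right, rfl⟩
    have hle : Submodule.span ℝ {x | ∃ v : Fin n, nbhd G v ⊆ U ∧ G.adjMatrix ℝ v = x} ≤
        LinearMap.ker (LinearMap.proj (R := ℝ) (φ := fun _ : Fin n => ℝ) ⟨j, hjn⟩) := by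
      rw [Submodule.span_le]
      rintro _ ⟨u, hu, rfl⟩
      have : ¬ G.Adj u ⟨j, hjn⟩ := fun h => hjU (hu ((val_mem_nbhd G).2 h))
      simp [SimpleGraph.adjMatrix_apply, this]
    have := hle hmem
    simp [SimpleGraph.adjMatrix_apply, hadj] at this

theorem hasVertexCover_of_covers {U : Finset ℕ} (hk : U.card ≤ k)
    (hkn : k ≤ n) (h : Covers n (nbhd G) U) : HasVertexCover G k := by
  have hcard : (Finset.univ.filter fun v : Fin n => (v : ℕ) ∈ U).card ≤ k := by
    refine le_trans ?_ hk
    exact Finset.card_le_card_of_injOn (fun v => (v : ℕ)) (fun v hv => by simpa using hv)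
      Fin.val_injective.injOn
  -- A cover of size at most `k` is padded to exactly `k` vertices, which needs `k ≤ n`.
  obtain ⟨S, hS, hSk⟩ := Finset.exists_superset_card_eq hcard (by simpa using hkn)
  refine ⟨S, hSk, fun u v huv => ?_⟩
  by_cases hu : (u : ℕ) ∈ U
  · exact .inl (hS (by simpa using hu))
  · exact .inr (hS (by simpa using h u u.2 hu ((val_mem_nbhd G).2 huv)))

theorem exists_tight_of_hasVertexCover (h : HasVertexCover G k) :
    ∃ X : Finset ℕ, X.card ≤ k ∧ Covers n (nbhd G) X ∧ Tight n (nbhd G) X := by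
  obtain ⟨S, hS, hcov⟩ := h
  obtain ⟨X, hX, h⟩ := exists_tight_subset (n := n) (N := nbhd G)
    (fun v hv => by simp [mem_nbhd] at hv)
    (fun u v h => by
      obtain ⟨hv, hu, hadj⟩ := (mem_nbhd G).1 h
      exact ⟨hv, hu, (mem_nbhd G).2 ⟨hu, hv, hadj.symm⟩⟩)
    (S.map Fin.valEmbedding)
    (fun i hi hiS j hj => by
      obtain ⟨_, hjn, hadj⟩ := (mem_nbhd G).1 hj
      have h₁ : (⟨i, hi⟩ : Fin n) ∉ S := fun h => hiS (Finset.mem_map.2 ⟨_, h, rfl⟩)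
      rcases hcov hadj with h | h
      · exact absurd h h₁
      · exact Finset.mem_map.2 ⟨_, h, rfl⟩)
    (fun i hi => by
      obtain ⟨v, -, rfl⟩ := Finset.mem_map.1 hi
      simp)
  exact ⟨X, (Finset.card_le_card hX).trans (by simp [hS]), h⟩

end Graph

/-- For `n ≥ 2`, use `n + 1 ≤ n ^ 2`. For `n = 1` the right side does not grow with `r`, so `R ≤ n`
is needed to bound `2 ^ R`. -/
theorem succ_pow_mul_le {n r R : ℕ} (hn : 1 ≤ n) (hr : 1 ≤ r) (hR : R ≤ r) (hRn : R ≤ n) :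
    (n + 1) ^ R * (n * (12 * n + 26) + 16) + 7 ≤ 1000 * n ^ (1000 * r) := by
  have h₁ : n * (12 * n + 26) + 16 ≤ 54 * n ^ 2 := by nlinarith
  have h₂ : (n + 1) ^ R ≤ 2 * n ^ (2 * r) := by
    rcases hn.eq_or_lt with rfl | hn
    · simpa using Nat.pow_le_pow_right (n := 2) (by norm_num) hRn
    · calc (n + 1) ^ R ≤ (n ^ 2) ^ R := Nat.pow_le_pow_left (by nlinarith) R
        _ ≤ (n ^ 2) ^ r := Nat.pow_le_pow_right (by positivity) hR
        _ = n ^ (2 * r) := (pow_mul n 2 r).symm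
        _ ≤ 2 * n ^ (2 * r) := by omega
  calc (n + 1) ^ R * (n * (12 * n + 26) + 16) + 7
      ≤ 2 * n ^ (2 * r) * (54 * n ^ 2) + 7 := by gcongr
    _ = 108 * n ^ (2 * r + 2) + 7 := by ring
    _ ≤ 1000 * n ^ (2 * r + 2) := by
      have : 1 ≤ n ^ (2 * r + 2) := Nat.one_le_pow _ _ hn
      omega
    _ ≤ 1000 * n ^ (1000 * r) := by gcongr; omega

end VertexCover

/-! ### Acceptance probability and conclusion -/

namespace RAM

theorem Exec.haltsWithin {w : List ℕ} {c : Cmd} {s : ℕ → ℕ} {t T : ℕ}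
    (h : Exec w c (fun _ => 0) s t) (hT : t ≤ T) : HaltsWithin (c.compile 0) w T := fun coins => by
  rw [h.run_compile _ (by simpa using hT)]
  exact (Cmd.length_compile c 0).le

theorem Exec.acceptProb {w : List ℕ} {c : Cmd} {s : ℕ → ℕ} {t T : ℕ}
    (h : Exec w c (fun _ => 0) s t) (hT : t ≤ T) :
    acceptProb (c.compile 0) w T = if s 0 = 1 then 1 else 0 := by
  have key (coins : Fin T → Bool) :
      Accepting (c.compile 0) (run (c.compile 0) w (List.ofFn coins)) ↔ s 0 = 1 := by
    rw [h.run_compile _ (by simpa using hT)]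
    exact and_iff_right (Cmd.length_compile c 0).le
  rw [RAM.acceptProb, Fintype.card_congr (Equiv.subtypeEquivRight key), Fintype.card_subtype]
  split_ifs with h0 <;> simp [h0]

end RAM

theorem theorem1p4 :
    ∃ (P : RAM.Program) (C : ℕ),
      ∀ (n r k : ℕ) (G : SimpleGraph (Fin n)) [DecidableRel G.Adj],
        1 ≤ n → 1 ≤ r → k ≤ n → (G.adjMatrix ℝ).rank ≤ r →
          RAM.HaltsWithin P (vertexCoverInput G k) (C * n ^ (C * r)) ∧
          (HasVertexCover G k →
            2 / 3 ≤ RAM.acceptProb P (vertexCoverInput G k) (C * n ^ (C * r))) ∧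
          (¬ HasVertexCover G k →
            RAM.acceptProb P (vertexCoverInput G k) (C * n ^ (C * r)) = 0) := by
  refine ⟨VertexCover.solve.compile 0, 1000, fun n r k G _ hn hr hk hrank => ?_⟩
  obtain ⟨s, t, ht, hexec, hsound, hcomplete⟩ :=
    VertexCover.wp_solve (w := vertexCoverInput G k) (k := k) hn rfl rfl
      (VertexCover.lists_vertexCoverInput G k) (VertexCover.nbhd_subset G)
      (VertexCover.rowDim_le_rank G) (fun _ _ hv h => VertexCover.rowDim_lt_rowDim_union G hv h)
  -- The exponent `R` is the rank itself rather than `r`, so that it is also at most `n`.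
  have hT := ht.trans (VertexCover.succ_pow_mul_le hn hr hrank
    (by simpa using (G.adjMatrix ℝ).rank_le_width))
  refine ⟨hexec.haltsWithin hT, fun hcov => ?_, fun hcov => ?_⟩
  · obtain ⟨X, hXk, hX, hX'⟩ := VertexCover.exists_tight_of_hasVertexCover G hcov
    rw [hexec.acceptProb hT, if_pos (hcomplete X hXk hX hX')]
    norm_num
  · rw [hexec.acceptProb hT, if_neg]
    intro h0
    obtain ⟨U, hUk, hcov'⟩ := hsound h0
    exact hcov (VertexCover.hasVertexCover_of_covers G hUk hk hcov')
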